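/- Let $R$ be a commutative ring, let $n\ge 1$ be an integer, and let $S=R[X_0,\dots,X_n]_{\mathbb Q}$ be the ring of polynomials in $X_0,\dots,X_n$ with nonnegative rational exponents, i.e. the free $R$-module on the monomials $X^e=X_0^{e_0}\cdots X_n^{e_n}$ with $e_i\in\mathbb Q_{\ge 0}$ and $X^eX^{e'}=X^{e+e'}$. Grade $S$ by total degree, $S=\bigoplus_{d\in\mathbb Q}S_d$ (with $S_d=0$ for $d<0$). Let $X=\operatorname{Proj} S$ be the space of homogeneous prime ideals of $S$ that do not contain $S_+=\bigoplus_{d>0}S_d$, with the Zariski topology, and for $m\in\mathbb Q$ let $\mathcal O_X(m)$ be the sheaf associated with the graded module $S(m)$, $S(m)_d=S_{m+d}$: a section over an open set $U$ assigns to each $\mathfrak p\in U$ an element of $S_{\mathfrak p}$, and is locally on $U$ of the form $a/s$ with $a\in S_{m+d}$ and $s\in S_d$ for some $d$. Let $H^0(X,\mathcal O_X(m))$ be the module of global sections, and let $H^n(X,\mathcal O_X(m))$ be the $n$-th cohomology module of the ordered (indices $i_0<\dots<i_p$) Čech complex of $\mathcal O_X(m)$ for the standard cover $U_i=D_+(X_i)$,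 $0\le i\le n$. Then: 1. There is an isomorphism of $R$-algebras $S\simeq\bigoplus_{m\in\mathbb Q}H^0(X,\mathcal O_X(m))$ that maps each $f\in S_m$ to the global section $f/1$ of $\mathcal O_X(m)$; here the right-hand side carries the multiplication $H^0(X,\mathcal O_X(l))\times H^0(X,\mathcal O_X(m))\to H^0(X,\mathcal O_X(l+m))$ of sections. 2. For every $m\in\mathbb Q$, the $R$-module $H^n(X,\mathcal O_X(m))$ is free, with a basis given by the classes of the monomials $X_0^{l_0}\cdots X_n^{l_n}$ (sections over $U_0\cap\dots\cap U_n$) with $l_i\in\mathbb Q$, $l_i<0$ for all $i$, and $l_0+\dots+l_n=m$. If $R\ne 0$, its rank is countably infinite for every $m<0$; in particular, $H^n(X,\mathcal O_X(-n-1))$ is free of infinite rank. -/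

import Mathlib

open TopologicalSpace

open scoped NNRat DirectSum

noncomputable section

namespace RatProj

/-! ## Proj of a `ℚ`-graded algebra, and the twisting sheaves on it -/

section Proj

variable {R A : Type*} [CommRing R] [CommRing A] [Algebra R A]
variable (𝒜 : ℚ → Submodule R A) [GradedAlgebra 𝒜]

/-- The ideal `A_+` generated by the homogeneous elements of positive degree. -/
def irrelevant : Ideal A := Ideal.span {a | ∃ d : ℚ, 0 < d ∧ a ∈ 𝒜 d}

/-- The points of `Proj A`: the homogeneous prime ideals that do not contain `A_+`. -/
@[ext]
structure Proj where
  asIdeal : Ideal A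
  isHomogeneous : asIdeal.IsHomogeneous 𝒜
  isPrime : asIdeal.IsPrime
  not_irrelevant_le : ¬ irrelevant 𝒜 ≤ asIdeal

attribute [instance] Proj.isPrime

/-- The Zariski topology: the subspace topology of the prime spectrum of `A`, so that the closed
sets are the sets `V_+(I) = {p | I ⊆ p}`. -/
instance : TopologicalSpace (Proj 𝒜) :=
  TopologicalSpace.induced (fun p => (⟨p.asIdeal, p.isPrime⟩ : PrimeSpectrum A)) inferInstance

/-- The open subset `D_+(f) = {p | f ∉ p}` of `Proj A`. -/
def basicOpen (f : A) : Opens (Proj 𝒜) :=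
  ⟨{p | f ∉ p.asIdeal},
    ⟨_, (PrimeSpectrum.basicOpen f).isOpen, rfl⟩⟩

/-- The module `Γ(U, 𝒪(m))`, where `𝒪(m)` is the sheaf associated with the graded module `A(m)`,
`A(m)_d = A_{m + d}`. A section over `U` assigns to every `p ∈ U` an element of the localization
of `A` at `p`, such that locally on `U` it is a fraction `a / s` with `a ∈ A(m)_d`, `s ∈ A_d`
for some `d`; restriction is restriction of functions. For `m = 0` it is the structure sheaf. -/
def sections (U : Opens (Proj 𝒜)) (m : ℚ) :
    Submodule R (∀ p : U, Localization.AtPrime p.1.asIdeal) where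
  carrier := {f | ∀ p : U, ∃ (V : Opens (Proj 𝒜)) (_ : p.1 ∈ V) (hVU : V ≤ U) (d : ℚ) (a s : A),
    a ∈ 𝒜 (m + d) ∧ s ∈ 𝒜 d ∧ ∀ q : V, ∃ hs : s ∉ q.1.asIdeal,
      f ⟨q.1, hVU q.2⟩ = Localization.mk a ⟨s, hs⟩}
  zero_mem' := by
    intro p
    refine ⟨U, p.2, le_rfl, 0, 0, 1, zero_mem _, SetLike.GradedOne.one_mem, fun q => ?_⟩
    exact ⟨fun h => q.1.isPrime.ne_top ((Ideal.eq_top_iff_one _).2 h),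
      (Localization.mk_zero _).symm⟩
  add_mem' := by
    intro f g hf hg p
    obtain ⟨V, hpV, hVU, d, a, s, ha, hs, hf⟩ := hf p
    obtain ⟨W, hpW, hWU, e, b, t, hb, ht, hg⟩ := hg p
    refine ⟨V ⊓ W, ⟨hpV, hpW⟩, inf_le_left.trans hVU, d + e, s * b + t * a, s * t,
      add_mem ?_ ?_, SetLike.GradedMul.mul_mem hs ht, fun q => ?_⟩
    · have h := SetLike.GradedMul.mul_mem hs hb
      rwa [show d + (m + e) = m + (d + e) by ring] at h
    · have h := SetLike.GradedMul.mul_mem ht ha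
      rwa [show e + (m + d) = m + (d + e) by ring] at h
    · obtain ⟨h₁, hf⟩ := hf ⟨q.1, q.2.1⟩
      obtain ⟨h₂, hg⟩ := hg ⟨q.1, q.2.2⟩
      refine ⟨fun h => (q.1.isPrime.mem_or_mem h).elim h₁ h₂, ?_⟩
      rw [Pi.add_apply, hf, hg, Localization.add_mk]
      rfl
  smul_mem' := by
    intro r f hf p
    obtain ⟨V, hpV, hVU, d, a, s, ha, hs, hf⟩ := hf p
    refine ⟨V, hpV, hVU, d, r • a, s, Submodule.smul_mem _ r ha, hs, fun q => ?_⟩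
    obtain ⟨h₁, hf⟩ := hf q
    refine ⟨h₁, ?_⟩
    rw [Pi.smul_apply, hf, Localization.smul_mk]

/-- The multiplication `Γ(U, 𝒪(l)) × Γ(U, 𝒪(m)) → Γ(U, 𝒪(l + m))`; it makes
`⨁ m, Γ(U, 𝒪(m))` a graded `R`-algebra. -/
instance (U : Opens (Proj 𝒜)) : SetLike.GradedMonoid (sections 𝒜 U) where
  one_mem := by
    intro p
    refine ⟨U, p.2, le_rfl, 0, 1, 1, ?_, SetLike.GradedOne.one_mem, fun q => ?_⟩
    · rw [add_zero]
      exact SetLike.GradedOne.one_mem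
    · exact ⟨fun h => q.1.isPrime.ne_top ((Ideal.eq_top_iff_one _).2 h),
        Localization.mk_one.symm⟩
  mul_mem := by
    intro l m f g hf hg p
    obtain ⟨V, hpV, hVU, d, a, s, ha, hs, hf⟩ := hf p
    obtain ⟨W, hpW, hWU, e, b, t, hb, ht, hg⟩ := hg p
    refine ⟨V ⊓ W, ⟨hpV, hpW⟩, inf_le_left.trans hVU, d + e, a * b, s * t,
      ?_, SetLike.GradedMul.mul_mem hs ht, fun q => ?_⟩
    · have h := SetLike.GradedMul.mul_mem ha hb
      rwa [show l + d + (m + e) = l + m + (d + e) by ring] at h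
    · obtain ⟨h₁, hf⟩ := hf ⟨q.1, q.2.1⟩
      obtain ⟨h₂, hg⟩ := hg ⟨q.1, q.2.2⟩
      refine ⟨fun h => (q.1.isPrime.mem_or_mem h).elim h₁ h₂, ?_⟩
      rw [Pi.mul_apply, hf, hg, Localization.mk_mul]
      rfl

/-- Restriction of sections of `𝒪(m)` to a smaller open set. -/
def restrict {U V : Opens (Proj 𝒜)} (h : V ≤ U) (m : ℚ) :
    sections 𝒜 U m →ₗ[R] sections 𝒜 V m where
  toFun f := ⟨fun p => f.1 ⟨p.1, h p.2⟩, by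
    intro p
    obtain ⟨W, hpW, hWU, d, a, s, ha, hs, hf⟩ := f.2 ⟨p.1, h p.2⟩
    exact ⟨W ⊓ V, ⟨hpW, p.2⟩, inf_le_right, d, a, s, ha, hs, fun q => hf ⟨q.1, q.2.1⟩⟩⟩
  map_add' _ _ := rfl
  map_smul' _ _ := rfl

/-- `H⁰(Proj A, 𝒪(m))`, the module of global sections. -/
abbrev H0 (m : ℚ) : Submodule R (∀ p : (⊤ : Opens (Proj 𝒜)), Localization.AtPrime p.1.asIdeal) :=
  sections 𝒜 ⊤ m

/-- The global section `f / 1` of `𝒪(m)` given by a homogeneous element `f` of degree `m`. -/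
def toH0 (m : ℚ) (f : 𝒜 m) : H0 𝒜 m :=
  ⟨fun _ => Localization.mk f.1 1, by
    intro p
    refine ⟨⊤, p.2, le_rfl, 0, f.1, 1, ?_, SetLike.GradedOne.one_mem, fun q => ?_⟩
    · rw [add_zero]
      exact f.2
    · exact ⟨fun h => q.1.isPrime.ne_top ((Ideal.eq_top_iff_one _).2 h), rfl⟩⟩

/-! ### Čech cohomology of `𝒪(m)` with respect to an ordered family of open sets -/

variable {ι : Type*} [LinearOrder ι] (U : ι → Opens (Proj 𝒜)) (m : ℚ)

/-- The intersection `U_{i_0} ∩ ⋯ ∩ U_{i_p}`, for `i_0 < ⋯ < i_p`. -/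
abbrev inter {p : ℕ} (σ : Fin (p + 1) ↪o ι) : Opens (Proj 𝒜) := ⨅ j, U (σ j)

/-- The Čech `p`-cochains: the product of the `Γ(U_{i_0} ∩ ⋯ ∩ U_{i_p}, 𝒪(m))` over all
`i_0 < ⋯ < i_p`. -/
def CechCochain (p : ℕ) : Type _ :=
  ∀ σ : Fin (p + 1) ↪o ι, sections 𝒜 (inter 𝒜 U σ) m

instance (p : ℕ) : AddCommGroup (CechCochain 𝒜 U m p) :=
  inferInstanceAs (AddCommGroup (∀ σ : Fin (p + 1) ↪o ι, sections 𝒜 (inter 𝒜 U σ) m))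

instance (p : ℕ) : Module R (CechCochain 𝒜 U m p) :=
  inferInstanceAs (Module R (∀ σ : Fin (p + 1) ↪o ι, sections 𝒜 (inter 𝒜 U σ) m))

/-- Omitting the `k`-th index enlarges the intersection. -/
theorem inter_le {p : ℕ} (τ : Fin (p + 2) ↪o ι) (k : Fin (p + 2)) :
    inter 𝒜 U τ ≤ inter 𝒜 U ((Fin.succAboveOrderEmb k).trans τ) :=
  le_iInf fun j => iInf_le (fun j => U (τ j)) (k.succAbove j)

/-- The Čech differential
`(d s)_{i_0 ⋯ i_{p+1}} = ∑_k (-1)^k s_{i_0 ⋯ î_k ⋯ i_{p+1}}` (restricted to the intersection). -/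
def cechD (p : ℕ) : CechCochain 𝒜 U m p →ₗ[R] CechCochain 𝒜 U m (p + 1) :=
  LinearMap.pi fun τ => ∑ k : Fin (p + 2), (-1 : R) ^ (k : ℕ) •
    ((restrict 𝒜 (inter_le 𝒜 U τ k) m).comp
      (LinearMap.proj ((Fin.succAboveOrderEmb k).trans τ)))

/-- The Čech cocycles. -/
abbrev cechZ (p : ℕ) : Submodule R (CechCochain 𝒜 U m p) := LinearMap.ker (cechD 𝒜 U m p)

/-- The Čech coboundaries. -/
def cechB : ∀ p : ℕ, Submodule R (CechCochain 𝒜 U m p)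
  | 0 => ⊥
  | p + 1 => LinearMap.range (cechD 𝒜 U m p)

/-- The Čech cohomology module `Ȟ^p(U, 𝒪(m))`: cocycles modulo coboundaries. -/
abbrev CechH (p : ℕ) : Type _ :=
  cechZ 𝒜 U m p ⧸ (cechB 𝒜 U m p).comap (cechZ 𝒜 U m p).subtype

end Proj

/-! ## Polynomials with rational exponents -/

section Poly

variable (R : Type*) [CommRing R] (n : ℕ)

/-- The ring `S = R[X_0, …, X_n]_ℚ` of polynomials with nonnegative rational exponents, the monoid
algebra of the additive monoid of exponent vectors. -/
abbrev Poly : Type _ := AddMonoidAlgebra R (Fin (n + 1) → ℚ≥0)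

/-- The total degree of an exponent vector. -/
def totalDeg : (Fin (n + 1) → ℚ≥0) →+ ℚ where
  toFun e := ∑ i, (e i : ℚ)
  map_zero' := by simp
  map_add' e e' := by simp [Finset.sum_add_distrib]

/-- The grading of `S` by total degree: `S_d` consists of the `R`-linear combinations of monomials
of total degree `d`. -/
abbrev grading : ℚ → Submodule R (Poly R n) := AddMonoidAlgebra.gradeBy R (totalDeg n)

variable {n}

/-- The monomial `X^e = X_0^{e_0} ⋯ X_n^{e_n}`. -/
def monomial (e : Fin (n + 1) → ℚ≥0) : Poly R n := AddMonoidAlgebra.single e 1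

variable (n)

/-- The space `X = Proj S`. -/
abbrev PX : Type _ := Proj (grading R n)

/-- The standard open sets `U_i = D_+(X_i)`, which cover `X`. -/
def stdCover (i : Fin (n + 1)) : Opens (PX R n) :=
  basicOpen (grading R n) (monomial R (Pi.single i 1))

/-- The Čech cohomology `H^p(X, 𝒪(m))`, computed with the standard cover. -/
abbrev H (p : ℕ) (m : ℚ) : Type _ := CechH (grading R n) (stdCover R n) m p

/-- The exponents `(l_0, …, l_n) ∈ ℚ^{n+1}` with all `l_i < 0` and `l_0 + ⋯ + l_n = m`. -/
def NegExp (m : ℚ) : Type := {l : Fin (n + 1) → ℚ // (∀ i, l i < 0) ∧ ∑ i, l i = m}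

variable {n}

/-- The vector `-l` of positive exponents, for `l` with negative entries. -/
def negVec {m : ℚ} (l : NegExp n m) : Fin (n + 1) → ℚ≥0 :=
  fun i => ⟨-l.1 i, neg_nonneg.2 (l.2.1 i).le⟩

theorem monomial_add (e e' : Fin (n + 1) → ℚ≥0) :
    monomial R (e + e') = monomial R e * monomial R e' := by
  simp [monomial, AddMonoidAlgebra.single_mul_single]

theorem monomial_nsmul (k : ℕ) (e : Fin (n + 1) → ℚ≥0) :
    monomial R (k • e) = monomial R e ^ k := by
  simp [monomial, AddMonoidAlgebra.single_pow]

/-- A prime ideal that contains no `X_i` contains no monomial. -/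
theorem monomial_notMem {P : Ideal (Poly R n)} (hP : P.IsPrime)
    (h : ∀ i, monomial R (Pi.single i 1) ∉ P) (e : Fin (n + 1) → ℚ≥0) :
    monomial R e ∉ P := by
  have key : ∀ (i : Fin (n + 1)) (q : ℚ≥0), monomial R (Pi.single i q) ∉ P := by
    intro i q hq
    apply h i
    have h1 : monomial R (Pi.single i (q.num : ℚ≥0)) ∈ P := by
      have : (Pi.single i (q.num : ℚ≥0) : Fin (n + 1) → ℚ≥0) = q.den • Pi.single i q := by
        rw [← Pi.single_smul, nsmul_eq_mul, mul_comm, NNRat.mul_den_eq_num]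
      rw [this, monomial_nsmul]
      exact Ideal.pow_mem_of_mem _ hq _ q.den_pos
    have h2 : (Pi.single i (q.num : ℚ≥0) : Fin (n + 1) → ℚ≥0) = q.num • Pi.single i 1 := by
      rw [← Pi.single_smul, nsmul_eq_mul, mul_one]
    rw [h2, monomial_nsmul] at h1
    exact hP.mem_of_pow_mem _ h1
  have hs : e = ∑ i, Pi.single i (e i) := (Finset.univ_sum_single e).symm
  have hp : monomial R e = ∏ i, monomial R (Pi.single i (e i)) := by
    conv_lhs => rw [hs]
    induction (Finset.univ : Finset (Fin (n + 1))) using Finset.induction_on with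
    | empty => simp [monomial, AddMonoidAlgebra.one_def]
    | insert a s ha ih => rw [Finset.sum_insert ha, Finset.prod_insert ha, monomial_add, ih]
  rw [hp, Ideal.IsPrime.prod_mem_iff]
  rintro ⟨i, _, hi⟩
  exact key i _ hi

theorem monomial_notMem_of_mem_inter (σ : Fin (n + 1) ↪o Fin (n + 1))
    (p : inter (grading R n) (stdCover R n) σ) (e : Fin (n + 1) → ℚ≥0) :
    monomial R e ∉ p.1.asIdeal := by
  refine monomial_notMem R p.1.isPrime (fun i => ?_) e
  obtain ⟨j, rfl⟩ := (Finite.injective_iff_surjective.1 σ.injective) i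
  exact (iInf_le (fun j => stdCover R n (σ j)) j) p.2

/-- The section `X^l = 1 / X^{-l}` of `𝒪(m)` over `U_0 ∩ ⋯ ∩ U_n`, where all `l_i < 0` and
`l_0 + ⋯ + l_n = m`. -/
def negMonomial {m : ℚ} (l : NegExp n m) (σ : Fin (n + 1) ↪o Fin (n + 1)) :
    sections (grading R n) (inter (grading R n) (stdCover R n) σ) m :=
  ⟨fun p => Localization.mk 1
      ⟨monomial R (negVec l), monomial_notMem_of_mem_inter R σ p (negVec l)⟩, by
    intro p
    refine ⟨_, p.2, le_rfl, totalDeg n (negVec l), 1, monomial R (negVec l), ?_,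
      AddMonoidAlgebra.single_mem_gradeBy _ _ _,
      fun q => ⟨monomial_notMem_of_mem_inter R σ q (negVec l), rfl⟩⟩
    have : m + totalDeg n (negVec l) = 0 := by
      have h : totalDeg n (negVec l) = ∑ i, -l.1 i := rfl
      rw [h, Finset.sum_neg_distrib, l.2.2, add_neg_cancel]
    rw [this]
    exact SetLike.GradedOne.one_mem⟩

/-- There are no indices `i_0 < ⋯ < i_{n+1}` in `{0, …, n}`, so every `n`-cochain is a cocycle. -/
theorem mem_cechZ_top {m : ℚ} (s : CechCochain (grading R n) (stdCover R n) m n) :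
    s ∈ cechZ (grading R n) (stdCover R n) m n := by
  rw [LinearMap.mem_ker]
  funext τ
  have h := Fintype.card_le_of_injective τ τ.injective
  simp at h

/-- The class in `H^n(X, 𝒪(m))` of the monomial `X^l`, where all `l_i < 0` and
`l_0 + ⋯ + l_n = m`. -/
def negMonomialClass {m : ℚ} (l : NegExp n m) : H R n n m :=
  Submodule.Quotient.mk ⟨fun σ => negMonomial R l σ, mem_cechZ_top R _⟩

end Poly

end RatProj

end

/-!
The computation takes place inside `S = R[X_0, …, X_n]_ℚ` itself; the ring of Laurent polynomials
is not needed, because all denominators that occur are monomials, which are not zero divisors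
(`monomial_mul_cancel`).

The basic input holds for every `ℚ`-graded algebra `A`: over `D_+(g)`, with `g` homogeneous of
positive degree, a section of `𝒪(m)` is a single fraction `b / g ^ M`
(`exists_pow_mul_section_eq`). The homogeneous core of a prime ideal is prime, so primes of `A` that
miss `g` give points of `D_+(g)`. Hence the denominators of the local fractions generate an ideal
whose radical contains `g`, finitely many of them suffice to generate a power of `g`, and the local
fractions are glued with the coefficients of such a relation, after multiplying by powers that make
them compatible (`exists_pow_mul_eq_zero`).

*Global sections.* A global section is `b_i / X_i ^ N` on `U_i`, and
`X_1 ^ N * b_0 = X_0 ^ N * b_1`. Comparing exponents, `X_0 ^ N` divides `b_0`; the quotient is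
a polynomial that represents the section on every `U_i` (`toH0_surjective`). This uses `n ≥ 1`.

*Top cohomology.* A section over `U_0 ∩ ⋯ ∩ U_n` is a combination of the fractions
`X^x / (X_0 ⋯ X_n) ^ N`. If some `x_i ≥ N`, the fraction extends to the intersection of the
remaining `U_j` and is a coboundary; otherwise it is a monomial with negative exponents. So the
classes of these monomials generate (`span_negMonomialClass`). They are independent
(`linearIndependent_negMonomialClass`): in a relation modulo coboundaries, multiply by a power
`(X_0 ⋯ X_n) ^ N` that clears all denominators; every monomial coming from the coboundary is then
divisible by some `X_i ^ N`, and none of the others is. Finally, for `m < 0` and `n ≥ 1` the set of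
exponents is countably infinite (`mk_negExp`).
-/

noncomputable section

namespace RatProj

/-! ### Sections over basic open sets -/

section Graded

variable {R A : Type*} [CommRing R] [CommRing A] [Algebra R A]
variable {𝒜 : ℚ → Submodule R A} [GradedAlgebra 𝒜]

/-- The homogeneous core of a prime `P` is again prime, so a prime that misses some homogeneous
element of positive degree determines a point of `Proj A`, with the same homogeneous elements. -/
theorem exists_proj_mem_iff {P : Ideal A} (hP : P.IsPrime) {γ : ℚ} {g : A} (hγ : 0 < γ)
    (hg : g ∈ 𝒜 γ) (hgP : g ∉ P) :
    ∃ p : Proj 𝒜, ∀ d, ∀ a ∈ 𝒜 d, a ∈ p.asIdeal ↔ a ∈ P := by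
  refine ⟨⟨(P.homogeneousCore 𝒜).toIdeal, (P.homogeneousCore 𝒜).isHomogeneous,
    hP.homogeneousCore, fun h => hgP ?_⟩, fun d a ha => ⟨fun h => ?_, fun h => ?_⟩⟩
  · exact Ideal.toIdeal_homogeneousCore_le 𝒜 P (h (Ideal.subset_span ⟨γ, hγ, hg⟩))
  · exact Ideal.toIdeal_homogeneousCore_le 𝒜 P h
  · exact Ideal.mem_homogeneousCore_of_homogeneous_of_mem ⟨d, ha⟩ h

theorem exists_decompose_notMem (p : Proj 𝒜) {s : A} (hs : s ∉ p.asIdeal) :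
    ∃ d, (DirectSum.decompose 𝒜 s d : A) ∉ p.asIdeal := by
  classical
  by_contra! h
  apply hs
  rw [← DirectSum.sum_support_decompose 𝒜 s]
  exact Ideal.sum_mem _ fun d _ => h d

/-- The sets `D_+(h)`, with `h` homogeneous, form a basis of the topology. -/
theorem exists_homogeneous_basicOpen_le (V : Opens (Proj 𝒜)) {p : Proj 𝒜} (hp : p ∈ V) :
    ∃ d, ∃ h ∈ 𝒜 d, h ∉ p.asIdeal ∧ ∀ q : Proj 𝒜, h ∉ q.asIdeal → q ∈ V := by
  obtain ⟨W, hW, hWV⟩ := isOpen_induced_iff.1 V.isOpen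
  have hpW : (⟨p.asIdeal, p.isPrime⟩ : PrimeSpectrum A) ∈ W := by
    have : p ∈ (V : Set (Proj 𝒜)) := hp
    rwa [← hWV] at this
  obtain ⟨_, ⟨s, rfl⟩, hps, hsW⟩ :=
    PrimeSpectrum.isTopologicalBasis_basic_opens.exists_subset_of_mem_open hpW hW
  obtain ⟨d, hd⟩ := exists_decompose_notMem p (s := s) hps
  refine ⟨d, _, (DirectSum.decompose 𝒜 s d).2, hd, fun q hq => ?_⟩
  have : q ∈ (V : Set (Proj 𝒜)) := by
    rw [← hWV]
    exact hsW fun hs => hq (q.isHomogeneous d hs)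
  exact this

/-- A homogeneous element `a` that vanishes in the local rings at all points of `D_+(g) ∩ D_+(t)`
is killed by a power of `g * t`. Only `g` is required to have positive degree. -/
theorem exists_pow_mul_eq_zero {γ d e : ℚ} {g t a : A} (hγ : 0 < γ) (hg : g ∈ 𝒜 γ)
    (ht : t ∈ 𝒜 d) (ha : a ∈ 𝒜 e)
    (h : ∀ q : Proj 𝒜, g ∉ q.asIdeal → t ∉ q.asIdeal →
      algebraMap A (Localization.AtPrime q.asIdeal) a = 0) :
    ∃ k : ℕ, (g * t) ^ k * a = 0 := by
  by_contra! hk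
  -- Otherwise some prime containing the annihilator of `a` misses `g * t`.
  have hdisj : Disjoint ((Ideal.span {a}).annihilator : Set A) (Submonoid.powers (g * t)) := by
    rw [Set.disjoint_left]
    rintro _ hx ⟨k, rfl⟩
    exact hk k (by simpa [Submodule.mem_annihilator_span_singleton] using hx)
  obtain ⟨P, hP, hle, hdP⟩ := Ideal.exists_le_prime_disjoint _ _ hdisj
  have hgt : g * t ∉ P := fun h' =>
    Set.disjoint_left.1 hdP h' (Submonoid.mem_powers _)
  have hgP : g ∉ P := fun h' => hgt (P.mul_mem_right _ h')
  have htP : t ∉ P := fun h' => hgt (P.mul_mem_left _ h')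
  obtain ⟨p, hp⟩ := exists_proj_mem_iff hP hγ hg hgP
  have h0 := h p (fun h' => hgP ((hp _ _ hg).1 h')) (fun h' => htP ((hp _ _ ht).1 h'))
  obtain ⟨⟨s, hs⟩, hsa⟩ :=
    (IsLocalization.map_eq_zero_iff p.asIdeal.primeCompl
      (Localization.AtPrime p.asIdeal) a).1 h0
  obtain ⟨i, hi⟩ := exists_decompose_notMem p hs
  apply hi
  rw [hp _ _ (DirectSum.decompose 𝒜 s i).2]
  apply hle
  rw [Submodule.mem_annihilator_span_singleton, smul_eq_mul,
    ← DirectSum.coe_decompose_mul_add_of_right_mem 𝒜 ha, hsa]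
  simp

/-- The denominators `t` for which a section `f` over `D_+(g)` is a fraction `b / t` on all of
`D_+(g) ∩ D_+(t)` generate an ideal whose radical contains `g`. -/
theorem mem_radical_span_denominators {U : Opens (Proj 𝒜)} {γ m : ℚ} {g : A} (hγ : 0 < γ)
    (hg : g ∈ 𝒜 γ) (hU : ∀ p, p ∈ U ↔ g ∉ p.asIdeal) (f : sections 𝒜 U m) :
    g ∈ (Ideal.span {t : A | ∃ d b, t ∈ 𝒜 d ∧ b ∈ 𝒜 (m + d) ∧ ∀ q : U, t ∉ q.1.asIdeal →
      algebraMap A (Localization.AtPrime q.1.asIdeal) t * f.1 q = algebraMap A _ b}).radical := by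
  rw [Ideal.radical_eq_sInf, Submodule.mem_sInf]
  rintro P ⟨hle, hP⟩
  by_contra hgP
  obtain ⟨p, hp⟩ := exists_proj_mem_iff hP hγ hg hgP
  have hpU : p ∈ U := (hU p).2 fun h => hgP ((hp _ _ hg).1 h)
  obtain ⟨V, hpV, hVU, d, a, s, ha, hs, hf⟩ := f.2 ⟨p, hpU⟩
  obtain ⟨e, h, he, hhp, hhV⟩ := exists_homogeneous_basicOpen_le V hpV
  obtain ⟨hsp, -⟩ := hf ⟨p, hpV⟩
  have hmem : h * s ∈ 𝒜 (e + d) := SetLike.GradedMul.mul_mem he hs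
  have hnot : h * s ∉ p.asIdeal := fun h' => (p.isPrime.mem_or_mem h').elim hhp hsp
  refine hnot ((hp _ _ hmem).2 (hle (Ideal.subset_span ⟨e + d, h * a, hmem, ?_, fun q hq => ?_⟩)))
  · have := SetLike.GradedMul.mul_mem he ha
    rwa [show e + (m + d) = m + (e + d) by ring] at this
  · have hqV : q.1 ∈ V := hhV _ fun h' => hq (Ideal.mul_mem_right _ _ h')
    obtain ⟨hsq, hfq⟩ := hf ⟨q.1, hqV⟩
    have hfq : f.1 q = Localization.mk a ⟨s, hsq⟩ := hfq
    rw [hfq, map_mul, map_mul, mul_assoc, Localization.mk_eq_mk']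
    congr 1
    exact IsLocalization.mk'_spec' (Localization.AtPrime q.1.asIdeal) a
      (⟨s, hsq⟩ : q.1.asIdeal.primeCompl)

/-- Over `D_+(g)`, with `g` homogeneous of positive degree `γ`, every section of `𝒪(m)` is a
fraction `b / g ^ M` with `b` homogeneous, for all large `M`. -/
theorem exists_pow_mul_section_eq {U : Opens (Proj 𝒜)} {γ m : ℚ} {g : A} (hγ : 0 < γ)
    (hg : g ∈ 𝒜 γ) (hU : ∀ p, p ∈ U ↔ g ∉ p.asIdeal) (f : sections 𝒜 U m) :
    ∃ M₀ : ℕ, ∀ M ≥ M₀, ∃ b ∈ 𝒜 (m + M • γ), ∀ q : U,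
      algebraMap A (Localization.AtPrime q.1.asIdeal) (g ^ M) * f.1 q = algebraMap A _ b := by
  suffices h : ∃ M : ℕ, ∃ b ∈ 𝒜 (m + M • γ), ∀ q : U,
      algebraMap A (Localization.AtPrime q.1.asIdeal) (g ^ M) * f.1 q = algebraMap A _ b by
    obtain ⟨M₀, b, hb, h⟩ := h
    refine ⟨M₀, fun M hM => ?_⟩
    obtain ⟨k, rfl⟩ := Nat.exists_eq_add_of_le hM
    refine ⟨g ^ k * b, ?_, fun q => ?_⟩
    · have := SetLike.GradedMul.mul_mem (SetLike.pow_mem_graded k hg) hb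
      rwa [show k • γ + (m + M₀ • γ) = m + (M₀ + k) • γ by rw [add_smul]; ring] at this
    · rw [pow_add, mul_comm (g ^ M₀), map_mul, mul_assoc, h q, map_mul]
  obtain ⟨N, hN⟩ := mem_radical_span_denominators hγ hg hU f
  obtain ⟨F, hFT, hNF⟩ := Submodule.mem_span_finite_of_mem_span hN
  have hFT' : ∀ t ∈ F, ∃ d b, t ∈ 𝒜 d ∧ b ∈ 𝒜 (m + d) ∧ ∀ q : U, t ∉ q.1.asIdeal →
      algebraMap A (Localization.AtPrime q.1.asIdeal) t * f.1 q = algebraMap A _ b :=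
    fun t ht => hFT ht
  choose! d b hd hb hfb using hFT'
  -- Two of the local fractions agree up to a power of `g` and of the denominators.
  have hk : ∀ x : F × F, ∃ k : ℕ,
      (g * (x.1.1 * x.2.1)) ^ k * (x.2.1 * b x.1.1 - x.1.1 * b x.2.1) = 0 := by
    rintro ⟨⟨s, hs⟩, ⟨t, ht⟩⟩
    refine exists_pow_mul_eq_zero (e := m + d s + d t) hγ hg
      (SetLike.GradedMul.mul_mem (hd _ hs) (hd _ ht)) (sub_mem ?_ ?_) fun q hgq hst => ?_
    · have := SetLike.GradedMul.mul_mem (hd _ ht) (hb _ hs)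
      rwa [show d t + (m + d s) = m + d s + d t by ring] at this
    · have := SetLike.GradedMul.mul_mem (hd _ hs) (hb _ ht)
      rwa [show d s + (m + d t) = m + d s + d t by ring] at this
    · have h1 := hfb _ hs ⟨q, (hU q).2 hgq⟩ fun h => hst (Ideal.mul_mem_right _ _ h)
      have h2 := hfb _ ht ⟨q, (hU q).2 hgq⟩ fun h => hst (Ideal.mul_mem_left _ _ h)
      simp only [map_sub, map_mul]
      rw [← h1, ← h2]
      ring
  choose κ hκ using hk
  -- One exponent `k` serves all pairs of denominators.
  obtain ⟨k, hkκ⟩ : ∃ k, ∀ x, κ x ≤ k :=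
    ⟨Finset.univ.sup κ, fun x => Finset.le_sup (Finset.mem_univ x)⟩
  have hst : ∀ s t : F, g ^ k * t.1 ^ (k + 1) * (s.1 ^ k * b s) =
      g ^ k * s.1 ^ (k + 1) * (t.1 ^ k * b t) := by
    intro s t
    have : (g * (s.1 * t.1)) ^ k * (t.1 * b s - s.1 * b t) = 0 := by
      obtain ⟨j, hj⟩ := Nat.exists_eq_add_of_le (hkκ (s, t))
      rw [hj, pow_add, mul_right_comm, hκ (s, t), zero_mul]
    rw [← sub_eq_zero, ← this]
    ring
  -- The powers `t ^ (k + 1)` still generate a power of `g`, with homogeneous coefficients.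
  have hrad : g ∈ (Ideal.span (Set.range fun t : F => t.1 ^ (k + 1))).radical := by
    have hle : Ideal.span (F : Set A) ≤
        (Ideal.span (Set.range fun t : F => t.1 ^ (k + 1))).radical :=
      Ideal.span_le.2 fun t ht => ⟨k + 1, Ideal.subset_span ⟨⟨t, ht⟩, rfl⟩⟩
    exact Ideal.mem_radical_of_pow_mem (hle hNF)
  obtain ⟨M, hM⟩ := hrad
  obtain ⟨c, hc⟩ := Ideal.mem_span_range_iff_exists_fun.1 hM
  set c' : F → A := fun t => DirectSum.decompose 𝒜 (c t) (M • γ - (k + 1) • d t)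
  have hc' : ∑ t, c' t * t.1 ^ (k + 1) = g ^ M := by
    have h1 : (DirectSum.decompose 𝒜 (g ^ M) (M • γ) : A) = g ^ M :=
      DirectSum.decompose_of_mem_same 𝒜 (SetLike.pow_mem_graded M hg)
    rw [← hc, DirectSum.decompose_sum, DFinsupp.finsetSum_apply,
      AddSubmonoidClass.coe_finsetSum] at h1
    rw [← hc, ← h1]
    refine Finset.sum_congr rfl fun t _ => ?_
    have := DirectSum.coe_decompose_mul_add_of_right_mem 𝒜 (a := c t) (i := M • γ - (k + 1) • d t.1)
      (SetLike.pow_mem_graded (k + 1) (hd _ t.2))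
    rw [sub_add_cancel] at this
    exact this.symm
  refine ⟨M, ∑ t, c' t * (t.1 ^ k * b t), sum_mem fun t _ => ?_, fun q => ?_⟩
  · have := SetLike.GradedMul.mul_mem (DirectSum.decompose 𝒜 (c t) (M • γ - (k + 1) • d t.1)).2
      (SetLike.GradedMul.mul_mem (SetLike.pow_mem_graded k (hd _ t.2)) (hb _ t.2))
    rwa [show M • γ - (k + 1) • d t.1 + (k • d t.1 + (m + d t.1)) = m + M • γ by
      rw [add_smul, one_smul]; ring] at this
  · have hgq := (hU q.1).1 q.2
    -- It suffices to compare with the local fraction for one denominator without zero at `q`.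
    obtain ⟨t, ht⟩ : ∃ t : F, t.1 ∉ q.1.asIdeal := by
      by_contra! h
      refine hgq (q.1.isPrime.mem_of_pow_mem M ?_)
      rw [← hc']
      exact Ideal.sum_mem _ fun t _ => Ideal.mul_mem_left _ _
        (Ideal.pow_mem_of_mem _ (h t) _ k.succ_pos)
    have hunit : IsUnit (algebraMap A (Localization.AtPrime q.1.asIdeal)
        (g ^ k * t.1 ^ (k + 1))) := by
      refine IsLocalization.map_units (Localization.AtPrime q.1.asIdeal)
        (⟨_, fun h => ?_⟩ : q.1.asIdeal.primeCompl)
      exact (q.1.isPrime.mem_or_mem h).elim (fun h => hgq (q.1.isPrime.mem_of_pow_mem _ h))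
        fun h => ht (q.1.isPrime.mem_of_pow_mem _ h)
    refine hunit.mul_left_cancel ?_
    have hft := hfb _ t.2 q ht
    have hb' : g ^ k * t.1 ^ (k + 1) * ∑ s, c' s * (s.1 ^ k * b s) =
        g ^ k * g ^ M * t.1 ^ k * b t := by
      rw [← hc', Finset.mul_sum, Finset.mul_sum, Finset.sum_mul, Finset.sum_mul]
      refine Finset.sum_congr rfl fun s _ => ?_
      linear_combination c' s * hst s t
    rw [← map_mul, hb']
    simp only [map_mul, map_pow]
    rw [← hft]
    ring

/-- Sections over `U` are equal if they agree after multiplication by an element that vanishes at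
no point of `U`. -/
theorem section_ext {U : Opens (Proj 𝒜)} {m : ℚ} {f f' : sections 𝒜 U m} {s : A}
    (hs : ∀ p ∈ U, s ∉ p.asIdeal)
    (h : ∀ q : U, algebraMap A (Localization.AtPrime q.1.asIdeal) s * f.1 q =
      algebraMap A _ s * f'.1 q) : f = f' := by
  refine Subtype.ext (funext fun q => ?_)
  exact (IsLocalization.map_units (Localization.AtPrime q.1.asIdeal)
    (⟨s, hs _ q.2⟩ : q.1.asIdeal.primeCompl)).mul_left_cancel (h q)

/-- The section `a / s` of `𝒪(m)`, for `s` homogeneous without zeros on `U` and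
`deg a = m + deg s`, as a linear function of `a`. -/
def fracSection (U : Opens (Proj 𝒜)) (m : ℚ) {d : ℚ} {s : A} (hs : s ∈ 𝒜 d)
    (hU : ∀ p ∈ U, s ∉ p.asIdeal) : 𝒜 (m + d) →ₗ[R] sections 𝒜 U m where
  toFun a := ⟨fun p => Localization.mk a.1 ⟨s, hU _ p.2⟩, fun p =>
    ⟨U, p.2, le_rfl, d, a.1, s, a.2, hs, fun q => ⟨hU _ q.2, rfl⟩⟩⟩
  map_add' _ _ := Subtype.ext (funext fun _ => (Localization.add_mk_self _ _ _).symm)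
  map_smul' _ _ := Subtype.ext (funext fun _ => (Localization.smul_mk _ _ _).symm)

theorem mul_fracSection {U : Opens (Proj 𝒜)} {m d : ℚ} {s : A} (hs : s ∈ 𝒜 d)
    (hU : ∀ p ∈ U, s ∉ p.asIdeal) (a : 𝒜 (m + d)) (q : U) :
    algebraMap A (Localization.AtPrime q.1.asIdeal) s * (fracSection U m hs hU a).1 q =
      algebraMap A _ a.1 := by
  change algebraMap A (Localization.AtPrime q.1.asIdeal) s *
    Localization.mk a.1 (⟨s, hU _ q.2⟩ : q.1.asIdeal.primeCompl) = _
  rw [Localization.mk_eq_mk']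
  exact IsLocalization.mk'_spec' (Localization.AtPrime q.1.asIdeal) a.1
    (⟨s, hU _ q.2⟩ : q.1.asIdeal.primeCompl)

/-! ### The algebra of global sections -/

variable (𝒜) in
/-- The map `f ↦ f / 1` from homogeneous elements of degree `m` to global sections of `𝒪(m)`. -/
def toH0Linear (m : ℚ) : 𝒜 m →ₗ[R] H0 𝒜 m where
  toFun := toH0 𝒜 m
  map_add' _ _ := Subtype.ext (funext fun _ => (Localization.add_mk_self _ _ _).symm)
  map_smul' _ _ := Subtype.ext (funext fun _ => (Localization.smul_mk _ _ _).symm)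

variable (𝒜) in
/-- The homomorphism of algebras `⨁ m, A_m → ⨁ m, H⁰(Proj A, 𝒪(m))` that is `f ↦ f / 1` in every
degree. -/
def toH0AlgHom : (⨁ m, 𝒜 m) →ₐ[R] (⨁ m, H0 𝒜 m) :=
  DirectSum.toAlgebra R (fun m => 𝒜 m)
    (fun m => (DirectSum.lof R ℚ (fun m => H0 𝒜 m) m).comp (toH0Linear 𝒜 m))
    (by
      rw [LinearMap.comp_apply, DirectSum.lof_eq_of, DirectSum.one_def]
      congr 1
      exact Subtype.ext (funext fun _ => Localization.mk_one))
    (fun {i j} a b => by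
      rw [LinearMap.comp_apply, LinearMap.comp_apply, LinearMap.comp_apply, DirectSum.lof_eq_of,
        DirectSum.lof_eq_of, DirectSum.lof_eq_of, DirectSum.of_mul_of]
      congr 1
      refine Subtype.ext (funext fun p => ?_)
      refine Eq.trans ?_ (Localization.mk_mul _ _ _ _).symm
      rw [one_mul]
      rfl)

theorem toH0AlgHom_of (m : ℚ) (f : 𝒜 m) :
    toH0AlgHom 𝒜 (DirectSum.of (fun m => 𝒜 m) m f) =
      DirectSum.of (fun m => H0 𝒜 m) m (toH0 𝒜 m f) :=
  DirectSum.toAddMonoid_of (fun i => ((DirectSum.lof R ℚ (fun m => H0 𝒜 m) i).comp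
    (toH0Linear 𝒜 i)).toAddMonoidHom) m f

theorem toH0AlgHom_bijective (h : ∀ m, Function.Bijective (toH0 𝒜 m)) :
    Function.Bijective (toH0AlgHom 𝒜) := by
  have hmap : ⇑(toH0AlgHom 𝒜) = DirectSum.map fun m => (toH0Linear 𝒜 m).toAddMonoidHom := by
    funext x
    induction x using DirectSum.induction_on with
    | zero => rw [map_zero, map_zero]
    | of m f => rw [toH0AlgHom_of, DirectSum.map_of]; rfl
    | add x y hx hy => rw [map_add, map_add, hx, hy]
  rw [hmap]
  exact ⟨(DirectSum.map_injective _).2 fun m => (h m).1,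
    (DirectSum.map_surjective _).2 fun m => (h m).2⟩

/-- If `A_m → H⁰(Proj A, 𝒪(m))` is bijective for all `m`, then `A` is isomorphic, as an algebra,
to `⨁ m, H⁰(Proj A, 𝒪(m))`. -/
theorem exists_algEquiv_of_bijective (h : ∀ m, Function.Bijective (toH0 𝒜 m)) :
    ∃ φ : A ≃ₐ[R] (⨁ m : ℚ, H0 𝒜 m), ∀ (m : ℚ) (f : 𝒜 m),
      φ (f : A) = DirectSum.of (fun m : ℚ => H0 𝒜 m) m (toH0 𝒜 m f) := by
  refine ⟨(DirectSum.decomposeAlgEquiv 𝒜).trans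
    (AlgEquiv.ofBijective (toH0AlgHom 𝒜) (toH0AlgHom_bijective h)), fun m f => ?_⟩
  rw [AlgEquiv.trans_apply, AlgEquiv.ofBijective_apply, DirectSum.decomposeAlgEquiv_apply,
    DirectSum.decompose_coe]
  exact toH0AlgHom_of m f

end Graded

/-! ### Monomials and global sections on `Proj S` -/

section Monomials

variable {R : Type*} [CommRing R] {n : ℕ}

theorem monomial_mem_grading (e : Fin (n + 1) → ℚ≥0) :
    monomial R e ∈ grading R n (totalDeg n e) :=
  AddMonoidAlgebra.single_mem_gradeBy _ _ _

theorem coeff_monomial_mul_add (e x : Fin (n + 1) → ℚ≥0) (a : Poly R n) :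
    (monomial R e * a).coeff (e + x) = a.coeff x := by
  rw [monomial, AddMonoidAlgebra.coeff_single_mul_eq_mul_coeff x fun y _ => add_right_inj e,
    one_mul]

theorem coeff_monomial_mul_of_not_le {e x : Fin (n + 1) → ℚ≥0} (h : ¬ e ≤ x) (a : Poly R n) :
    (monomial R e * a).coeff x = 0 :=
  AddMonoidAlgebra.coeff_single_mul_of_forall_add_ne _ _ fun _ hd => h (hd ▸ le_self_add)

theorem monomial_mul_cancel {e : Fin (n + 1) → ℚ≥0} {a b : Poly R n}
    (h : monomial R e * a = monomial R e * b) : a = b := by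
  refine AddMonoidAlgebra.coeff_injective (Finsupp.ext fun x => ?_)
  rw [← coeff_monomial_mul_add e, h, coeff_monomial_mul_add]

/-- A polynomial is divisible by `X^e` if `e ≤ x` for all exponents `x` that occur in it. -/
theorem exists_eq_monomial_mul {e : Fin (n + 1) → ℚ≥0} {a : Poly R n}
    (h : ∀ x, ¬ e ≤ x → a.coeff x = 0) : ∃ c, a = monomial R e * c := by
  refine ⟨.ofCoeff (a.coeff.comapDomain (e + ·) (add_right_injective e).injOn), ?_⟩
  refine AddMonoidAlgebra.coeff_injective (Finsupp.ext fun x => ?_)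
  by_cases hx : e ≤ x
  · obtain ⟨y, rfl⟩ := exists_add_of_le hx
    rw [coeff_monomial_mul_add]
    rfl
  · rw [h x hx, coeff_monomial_mul_of_not_le hx]

theorem mem_grading_of_monomial_mul {e : Fin (n + 1) → ℚ≥0} {c : Poly R n} {d : ℚ}
    (h : monomial R e * c ∈ grading R n (d + totalDeg n e)) : c ∈ grading R n d := by
  intro x hx
  have h' : totalDeg n (e + x) = d + totalDeg n e := @h (e + x) (by
    rw [Finsupp.mem_support_iff, coeff_monomial_mul_add]
    exact Finsupp.mem_support_iff.1 hx)
  rw [map_add, add_comm] at h'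
  exact add_right_cancel h'

/-- Monomials are not zero divisors, so a homogeneous polynomial that vanishes in the local rings
at all points where some monomial of positive degree does not vanish is zero. -/
theorem eq_zero_of_forall_localization {e : Fin (n + 1) → ℚ≥0} (he : 0 < totalDeg n e)
    {d : ℚ} {a : Poly R n} (ha : a ∈ grading R n d)
    (h : ∀ q : PX R n, monomial R e ∉ q.asIdeal →
      algebraMap (Poly R n) (Localization.AtPrime q.asIdeal) a = 0) : a = 0 := by
  obtain ⟨k, hk⟩ := exists_pow_mul_eq_zero (t := 1) he (monomial_mem_grading e)
    SetLike.GradedOne.one_mem ha fun q hq _ => h q hq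
  rw [mul_one, ← monomial_nsmul, ← mul_zero (monomial R (k • e))] at hk
  exact monomial_mul_cancel hk

theorem eq_of_forall_localization {e : Fin (n + 1) → ℚ≥0} (he : 0 < totalDeg n e)
    {d : ℚ} {a b : Poly R n} (ha : a ∈ grading R n d) (hb : b ∈ grading R n d)
    (h : ∀ q : PX R n, monomial R e ∉ q.asIdeal →
      algebraMap (Poly R n) (Localization.AtPrime q.asIdeal) a = algebraMap _ _ b) : a = b := by
  refine sub_eq_zero.1 (eq_zero_of_forall_localization he (sub_mem ha hb) fun q hq => ?_)
  rw [map_sub, h q hq, sub_self]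

theorem totalDeg_single (i : Fin (n + 1)) (c : ℚ≥0) : totalDeg n (Pi.single i c) = c := by
  change ∑ j, ((Pi.single i c : Fin (n + 1) → ℚ≥0) j : ℚ) = c
  rw [Finset.sum_eq_single i (fun j _ hj => by rw [Pi.single_eq_of_ne hj]; rfl) (by simp),
    Pi.single_eq_same]

/-- The sets `D_+(X_i)` cover `Proj S`. -/
theorem exists_mem_stdCover (p : PX R n) : ∃ i, p ∈ stdCover R n i := by
  by_contra! h
  refine p.not_irrelevant_le (Ideal.span_le.2 ?_)
  rintro a ⟨d, hd, ha⟩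
  have hX : ∀ i, monomial R (Pi.single i 1) ∈ p.asIdeal := fun i => by
    by_contra hi
    exact h i hi
  rw [SetLike.mem_coe, ← AddMonoidAlgebra.sum_coeff_single a]
  refine Ideal.sum_mem _ fun x hx => ?_
  -- A monomial of positive degree has a positive exponent, so a power of it is divisible by
  -- some `X_i`.
  have hx' : totalDeg n x = d := @ha x hx
  obtain ⟨i, hi⟩ : ∃ i, x i ≠ 0 := by
    by_contra! h0
    rw [← hx', show x = 0 from funext h0, map_zero] at hd
    exact hd.false
  obtain ⟨k, hk⟩ := exists_nat_gt (x i)⁻¹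
  have hle : Pi.single i 1 ≤ k • x := by
    intro j
    by_cases hj : j = i
    · subst hj
      rw [Pi.single_eq_same, Pi.smul_apply, nsmul_eq_mul]
      have hpos : 0 < x j := pos_iff_ne_zero.2 hi
      calc (1 : ℚ≥0) = (x j)⁻¹ * x j := (inv_mul_cancel₀ hi).symm
        _ ≤ k * x j := by gcongr
    · rw [Pi.single_eq_of_ne hj]
      exact zero_le
  obtain ⟨y, hy⟩ := exists_add_of_le hle
  have hm : monomial R x ∈ p.asIdeal := by
    refine p.isPrime.mem_of_pow_mem k ?_
    rw [← monomial_nsmul, hy, monomial_add]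
    exact Ideal.mul_mem_right _ _ (hX i)
  have : AddMonoidAlgebra.single x (a.coeff x) = AddMonoidAlgebra.single 0 (a.coeff x) *
      monomial R x := by
    rw [monomial, AddMonoidAlgebra.single_mul_single, zero_add, mul_one]
  rw [this]
  exact Ideal.mul_mem_left _ _ hm

theorem toH0_injective (m : ℚ) : Function.Injective (toH0 (grading R n) m) := by
  intro f f' h
  refine Subtype.ext (eq_of_forall_localization (e := Pi.single 0 1) ?_ f.2 f'.2 fun q _ => ?_)
  · rw [totalDeg_single]
    exact zero_lt_one
  · have := congrFun (congrArg Subtype.val h) ⟨q, trivial⟩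
    exact this

/-- On `U_i` a global section is a fraction `b_i / X_i ^ N`. Comparing the fractions for `i = 0`
and `i = 1` shows that `X_0 ^ N` divides `b_0`, and the quotient represents the section
everywhere. -/
theorem toH0_surjective (hn : 1 ≤ n) (m : ℚ) : Function.Surjective (toH0 (grading R n) m) := by
  intro f
  let X : Fin (n + 1) → Fin (n + 1) → ℚ≥0 := fun i => Pi.single i 1
  have hX : ∀ i, totalDeg n (X i) = 1 := fun i => totalDeg_single i 1
  have hloc := fun i => exists_pow_mul_section_eq (U := stdCover R n i) (by rw [hX]; exact one_pos)
    (monomial_mem_grading (R := R) (X i)) (fun p => Iff.rfl)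
    (restrict (grading R n) (le_top : stdCover R n i ≤ ⊤) m f)
  choose N₀ hN₀ using hloc
  obtain ⟨N, hN⟩ : ∃ N, ∀ i, N₀ i ≤ N :=
    ⟨Finset.univ.sup N₀, fun i => Finset.le_sup (Finset.mem_univ i)⟩
  choose b hb hfb using fun i => hN₀ i N (hN i)
  simp only [← monomial_nsmul, ← map_nsmul] at hb hfb
  have hNX : ∀ i, totalDeg n (N • X i) = N := fun i => by rw [map_nsmul, hX, nsmul_one]
  have hX0 : ∀ i j, j ≠ i → (N • X i) j = 0 := fun i j hij => by
    rw [Pi.smul_apply, show X i j = 0 from Pi.single_eq_of_ne hij _, smul_zero]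
  have hfb' : ∀ i (q : PX R n), monomial R (X i) ∉ q.asIdeal →
      algebraMap _ (Localization.AtPrime q.asIdeal) (monomial R (N • X i)) * f.1 ⟨q, trivial⟩ =
        algebraMap _ _ (b i) := fun i q hq => hfb i ⟨q, hq⟩
  have hcross : ∀ i j, monomial R (N • X j) * b i = monomial R (N • X i) * b j := by
    intro i j
    have h1 := SetLike.GradedMul.mul_mem (monomial_mem_grading (R := R) (N • X j)) (hb i)
    have h2 := SetLike.GradedMul.mul_mem (monomial_mem_grading (R := R) (N • X i)) (hb j)
    rw [hNX, hNX] at h1 h2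
    refine eq_of_forall_localization (e := X i + X j) ?_ h1 h2 fun q hq => ?_
    · rw [map_add, hX, hX]
      norm_num
    · rw [monomial_add] at hq
      rw [map_mul, map_mul, ← hfb' i q fun h => hq (Ideal.mul_mem_right _ _ h),
        ← hfb' j q fun h => hq (Ideal.mul_mem_left _ _ h)]
      ring
  have h01 : (⟨1, by omega⟩ : Fin (n + 1)) ≠ 0 := by
    rw [Ne, Fin.ext_iff]
    exact one_ne_zero
  obtain ⟨c, hc⟩ : ∃ c, b 0 = monomial R (N • X 0) * c := by
    refine exists_eq_monomial_mul fun x hx => ?_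
    rw [← coeff_monomial_mul_add (N • X ⟨1, by omega⟩), hcross 0 ⟨1, by omega⟩]
    refine coeff_monomial_mul_of_not_le (fun hle => hx fun i => ?_) _
    by_cases hi : i = 0
    · subst hi
      have := hle 0
      rwa [Pi.add_apply, hX0 _ _ h01.symm, zero_add] at this
    · rw [hX0 _ _ hi]
      exact zero_le
  have hbc : ∀ i, b i = monomial R (N • X i) * c := by
    intro i
    have := hcross 0 i
    rw [hc, mul_left_comm] at this
    exact (monomial_mul_cancel this).symm
  have hcm : c ∈ grading R n m := by
    have := hb 0
    rw [hc] at this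
    exact mem_grading_of_monomial_mul this
  refine ⟨⟨c, hcm⟩, Subtype.ext (funext fun q => ?_)⟩
  obtain ⟨i, hi⟩ := exists_mem_stdCover q.1
  have hi' : monomial R (N • X i) ∉ q.1.asIdeal := by
    rw [monomial_nsmul]
    exact fun h => hi (q.1.isPrime.mem_of_pow_mem _ h)
  refine (IsLocalization.map_units (Localization.AtPrime q.1.asIdeal)
    (⟨_, hi'⟩ : q.1.asIdeal.primeCompl)).mul_left_cancel ?_
  refine Eq.trans ?_ (hfb' i q.1 hi).symm
  rw [hbc, map_mul]
  rfl

end Monomials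

/-! ### Čech cochains and the top cohomology -/

/-- If `s` is a fraction with denominator `z` and numerator `c`, then a multiple `y * z` of the
denominator has numerator `y * c`. -/
theorem map_mul_eq_of_eq_mul {A B : Type*} [CommRing A] [CommRing B] (φ : A →+* B) {x y z c : A}
    {s : B} (h : x = y * z) (hs : φ z * s = φ c) : φ x * s = φ (y * c) := by
  rw [h, map_mul, map_mul, mul_assoc, hs]

section Cochains

variable {R A : Type*} [CommRing R] [CommRing A] [Algebra R A]
variable {𝒜 : ℚ → Submodule R A} [GradedAlgebra 𝒜]
variable {ι : Type*} [LinearOrder ι] {U : ι → Opens (Proj 𝒜)} {m : ℚ} {p : ℕ}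

variable (R) in
/-- The component of a cochain at `i_0 < ⋯ < i_p`. -/
def component (σ : Fin (p + 1) ↪o ι) :
    CechCochain 𝒜 U m p →ₗ[R] sections 𝒜 (inter 𝒜 U σ) m where
  toFun c := c σ
  map_add' _ _ := rfl
  map_smul' _ _ := rfl

theorem component_cechD (s : CechCochain 𝒜 U m p) (τ : Fin (p + 2) ↪o ι) :
    component R τ (cechD 𝒜 U m p s) = ∑ k : Fin (p + 2), (-1 : R) ^ (k : ℕ) •
      restrict 𝒜 (inter_le 𝒜 U τ k) m
        (component R ((Fin.succAboveOrderEmb k).trans τ) s) :=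
  LinearMap.sum_apply Finset.univ (fun k : Fin (p + 2) => (-1 : R) ^ (k : ℕ) •
    (restrict 𝒜 (inter_le 𝒜 U τ k) m).comp
      (component R (U := U) ((Fin.succAboveOrderEmb k).trans τ))) s

/-- The germ of a section at a point, as an element of the localization. -/
def sectionAt {V : Opens (Proj 𝒜)} (q : V) :
    sections 𝒜 V m →ₗ[R] Localization.AtPrime q.1.asIdeal where
  toFun f := f.1 q
  map_add' _ _ := rfl
  map_smul' _ _ := rfl

/-- One component of a cochain can be prescribed, the others being zero. -/
theorem exists_cochain_single (σ : Fin (p + 1) ↪o ι) (s : sections 𝒜 (inter 𝒜 U σ) m) :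
    ∃ t : CechCochain 𝒜 U m p, component R σ t = s ∧
      ∀ σ', σ' ≠ σ → component R σ' t = 0 := by
  classical
  let t : ∀ σ : Fin (p + 1) ↪o ι, sections 𝒜 (inter 𝒜 U σ) m :=
    fun σ' => if h : σ' = σ then h ▸ s else 0
  have ht : t σ = s := dif_pos rfl
  have ht' : ∀ σ', σ' ≠ σ → t σ' = 0 := fun σ' h => dif_neg h
  exact ⟨t, ht, ht'⟩

/-- A section over `U_{i_0} ∩ ⋯ ∩ U_{i_{p+1}}` that extends to the intersection without `U_{i_j}` is
a component of a coboundary: the sign `(-1) ^ j` is absorbed into the cochain. -/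
theorem exists_component_cechD_eq_restrict (τ : Fin (p + 2) ↪o ι) (j : Fin (p + 2))
    (s : sections 𝒜 (inter 𝒜 U ((Fin.succAboveOrderEmb j).trans τ)) m) :
    ∃ t : CechCochain 𝒜 U m p,
      component R τ (cechD 𝒜 U m p t) = restrict 𝒜 (inter_le 𝒜 U τ j) m s := by
  obtain ⟨t, hts, ht⟩ := exists_cochain_single _ ((-1 : R) ^ (j : ℕ) • s)
  refine ⟨t, ?_⟩
  rw [component_cechD, Finset.sum_eq_single j, hts, map_smul, smul_smul, ← mul_pow, neg_one_mul,
    neg_neg, one_pow, one_smul]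
  · intro i _ hij
    rw [ht, map_zero, smul_zero]
    refine fun h => hij (Fin.succAbove_left_injective (funext fun x => τ.injective ?_))
    exact DFunLike.congr_fun h x
  · intro h
    exact absurd (Finset.mem_univ _) h

end Cochains

section TopCohomology

variable {R : Type*} [CommRing R] {n : ℕ}

/-- The exponent vector of `X_{i_0} ⋯ X_{i_p}`, so that `U_{i_0} ∩ ⋯ ∩ U_{i_p}` is the locus where
this monomial does not vanish. -/
def coverExp {p : ℕ} (σ : Fin (p + 1) ↪o Fin (n + 1)) : Fin (n + 1) → ℚ≥0 :=
  ∑ j, Pi.single (σ j) 1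

theorem monomial_sum {ι : Type*} (s : Finset ι) (e : ι → Fin (n + 1) → ℚ≥0) :
    monomial R (∑ j ∈ s, e j) = ∏ j ∈ s, monomial R (e j) := by
  classical
  induction s using Finset.induction_on with
  | empty => simp [monomial, AddMonoidAlgebra.one_def]
  | insert a s ha ih => rw [Finset.sum_insert ha, Finset.prod_insert ha, monomial_add, ih]

theorem mem_inter_iff {p : ℕ} (σ : Fin (p + 1) ↪o Fin (n + 1)) (q : PX R n) :
    q ∈ inter (grading R n) (stdCover R n) σ ↔ monomial R (coverExp σ) ∉ q.asIdeal := by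
  rw [coverExp, monomial_sum, Ideal.IsPrime.prod_mem_iff, inter, ← SetLike.mem_coe,
    Opens.coe_iInf, Set.mem_iInter]
  simp only [Finset.mem_univ, true_and, not_exists]
  rfl

theorem totalDeg_coverExp_pos {p : ℕ} (σ : Fin (p + 1) ↪o Fin (n + 1)) :
    0 < totalDeg n (coverExp σ) := by
  rw [coverExp, map_sum]
  simp only [totalDeg_single]
  simp
  positivity

theorem coverExp_eq_single_add {p : ℕ} (τ : Fin (p + 2) ↪o Fin (n + 1)) (k : Fin (p + 2)) :
    coverExp τ = Pi.single (τ k) 1 + coverExp ((Fin.succAboveOrderEmb k).trans τ) :=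
  Fin.sum_univ_succAbove _ k

theorem coverExp_eq_one (σ : Fin (n + 1) ↪o Fin (n + 1)) : coverExp σ = 1 := by
  rw [coverExp, Function.Bijective.sum_comp (Finite.injective_iff_bijective.1 σ.injective)
    fun i => (Pi.single i 1 : Fin (n + 1) → ℚ≥0)]
  exact Finset.univ_sum_single (1 : Fin (n + 1) → ℚ≥0)

/-- The only increasing map from `{0, …, n}` to itself is the identity, so a top-dimensional cochain
has a single component. -/
theorem orderEmb_eq_refl (σ : Fin (n + 1) ↪o Fin (n + 1)) : σ = RelEmbedding.refl _ := by
  have h := Subsingleton.elim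
    (RelIso.ofSurjective σ (Finite.surjective_of_injective σ.injective)) (OrderIso.refl _)
  exact RelEmbedding.ext fun i => DFunLike.congr_fun h i

theorem cochain_ext {m : ℚ} {c c' : CechCochain (grading R n) (stdCover R n) m n}
    (h : component R (RelEmbedding.refl _) c = component R (RelEmbedding.refl _) c') : c = c' := by
  funext σ
  obtain rfl := orderEmb_eq_refl σ
  exact h

/-- The class of a top-dimensional cochain in `H^n`. -/
def topClass (m : ℚ) : CechCochain (grading R n) (stdCover R n) m n →ₗ[R] H R n n m :=
  (Submodule.mkQ _).comp
    (LinearMap.id.codRestrict (cechZ (grading R n) (stdCover R n) m n) (mem_cechZ_top R))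

theorem topClass_surjective (m : ℚ) : Function.Surjective (topClass (R := R) (n := n) m) := by
  intro x
  obtain ⟨⟨c, hc⟩, rfl⟩ := Submodule.mkQ_surjective _ x
  exact ⟨c, rfl⟩

theorem topClass_eq_zero_iff {m : ℚ} (c : CechCochain (grading R n) (stdCover R n) m n) :
    topClass m c = 0 ↔ c ∈ cechB (grading R n) (stdCover R n) m n :=
  Submodule.Quotient.mk_eq_zero _

/-- A section over `U_0 ∩ ⋯ ∩ U_n` that extends to the intersection of all `U_i` but one is a
coboundary. -/
theorem topClass_eq_zero_of_extends {k : ℕ} {m : ℚ} (j : Fin (k + 2))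
    (c : CechCochain (grading R (k + 1)) (stdCover R (k + 1)) m (k + 1))
    (s : sections (grading R (k + 1)) (inter (grading R (k + 1)) (stdCover R (k + 1))
      ((Fin.succAboveOrderEmb j).trans (RelEmbedding.refl _))) m)
    (hs : component R (RelEmbedding.refl _) c =
      restrict (grading R (k + 1)) (inter_le (grading R (k + 1)) (stdCover R (k + 1))
        (RelEmbedding.refl _) j) m s) :
    topClass m c = 0 := by
  obtain ⟨t, ht⟩ := exists_component_cechD_eq_restrict (RelEmbedding.refl _) j s
  rw [topClass_eq_zero_iff]
  exact ⟨t, cochain_ext (ht.trans hs.symm)⟩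

/-- The top-dimensional cochain `b / X^e`. -/
def laurentCochain (m : ℚ) (e : Fin (n + 1) → ℚ≥0) :
    grading R n (m + totalDeg n e) →ₗ[R] CechCochain (grading R n) (stdCover R n) m n :=
  LinearMap.pi fun σ => fracSection _ m (monomial_mem_grading e) fun p hp =>
    monomial_notMem_of_mem_inter R σ ⟨p, hp⟩ e

theorem mul_laurentCochain {m : ℚ} {e : Fin (n + 1) → ℚ≥0} (b : grading R n (m + totalDeg n e))
    (σ : Fin (n + 1) ↪o Fin (n + 1)) (q : inter (grading R n) (stdCover R n) σ) :
    algebraMap _ (Localization.AtPrime q.1.asIdeal) (monomial R e) *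
      (component R σ (laurentCochain m e b)).1 q = algebraMap _ _ b.1 :=
  mul_fracSection (monomial_mem_grading e)
    (fun p hp => monomial_notMem_of_mem_inter R σ ⟨p, hp⟩ e) b q

variable (R) in
/-- The top-dimensional cochain `X^l`. -/
def negMonomialCochain {m : ℚ} (l : NegExp n m) : CechCochain (grading R n) (stdCover R n) m n :=
  fun σ => negMonomial R l σ

theorem mul_negMonomialCochain {m : ℚ} (l : NegExp n m) (σ : Fin (n + 1) ↪o Fin (n + 1))
    (q : inter (grading R n) (stdCover R n) σ) :
    algebraMap _ (Localization.AtPrime q.1.asIdeal) (monomial R (negVec l)) *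
      (component R σ (negMonomialCochain R l)).1 q = 1 := by
  change algebraMap _ (Localization.AtPrime q.1.asIdeal) (monomial R (negVec l)) *
    Localization.mk 1 (⟨_, monomial_notMem_of_mem_inter R σ q (negVec l)⟩ :
      q.1.asIdeal.primeCompl) = 1
  rw [Localization.mk_eq_mk']
  exact (IsLocalization.mk'_spec' (Localization.AtPrime q.1.asIdeal) 1
    (⟨_, monomial_notMem_of_mem_inter R σ q (negVec l)⟩ : q.1.asIdeal.primeCompl)).trans
    (map_one _)

/-- Every top-dimensional cochain is a fraction with denominator `(X_0 ⋯ X_n) ^ N`. -/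
theorem exists_eq_laurentCochain {m : ℚ} (c : CechCochain (grading R n) (stdCover R n) m n) :
    ∃ (N : ℕ) (b : grading R n (m + totalDeg n (N • 1))), c = laurentCochain m (N • 1) b := by
  obtain ⟨N, hN⟩ := exists_pow_mul_section_eq (totalDeg_coverExp_pos (RelEmbedding.refl _))
    (monomial_mem_grading _) (fun p => mem_inter_iff _ p) (component R (RelEmbedding.refl _) c)
  obtain ⟨b, hb, hcb⟩ := hN N le_rfl
  rw [← map_nsmul, coverExp_eq_one] at hb
  rw [← monomial_nsmul, coverExp_eq_one] at hcb
  refine ⟨N, ⟨b, hb⟩, cochain_ext ?_⟩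
  refine section_ext (fun p hp => monomial_notMem_of_mem_inter R _ ⟨p, hp⟩ (N • 1)) fun q => ?_
  rw [mul_laurentCochain]
  exact hcb q

/-- The class of `X^x / (X_0 ⋯ X_n) ^ N` is that of a monomial with negative exponents if all
`x_i < N`; otherwise some `X_i` does not occur in the denominator and the class is zero. -/
theorem topClass_laurentCochain_monomial_mem {k : ℕ} {m : ℚ} {N : ℕ} {x : Fin (k + 2) → ℚ≥0}
    (hx : monomial R x ∈ grading R (k + 1) (m + totalDeg (k + 1) (N • 1)))
    (hdeg : totalDeg (k + 1) x = m + totalDeg (k + 1) (N • 1)) :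
    topClass m (laurentCochain m (N • 1) ⟨monomial R x, hx⟩) ∈
      Submodule.span R (Set.range (negMonomialClass R (n := k + 1) (m := m))) := by
  by_cases h : ∀ i, x i < N
  · let l : NegExp (k + 1) m := ⟨fun i => (x i : ℚ) - N,
      fun i => sub_neg.2 (by exact_mod_cast h i), by
      have h1 : totalDeg (k + 1) x = ∑ i, (x i : ℚ) := rfl
      have h2 : totalDeg (k + 1) (N • 1 : Fin (k + 2) → ℚ≥0) = ∑ i : Fin (k + 2), (N : ℚ) := by
        change ∑ i, (((N • 1 : Fin (k + 2) → ℚ≥0) i : ℚ≥0) : ℚ) = _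
        exact Finset.sum_congr rfl fun i _ => by simp
      rw [Finset.sum_sub_distrib, ← h1, ← h2, hdeg, add_sub_cancel_right]⟩
    refine Submodule.subset_span ⟨l, congrArg (topClass m) (?_ :
      negMonomialCochain R l = laurentCochain m (N • 1) ⟨monomial R x, hx⟩)⟩
    refine cochain_ext ?_
    refine section_ext (fun p hp => monomial_notMem_of_mem_inter R _ ⟨p, hp⟩ (N • 1)) fun q => ?_
    have hxl : (N • 1 : Fin (k + 2) → ℚ≥0) = x + negVec l := by
      funext i
      refine NNRat.coe_injective ?_
      change (((N • 1 : Fin (k + 2) → ℚ≥0) i : ℚ≥0) : ℚ) = ((x i : ℚ≥0) : ℚ) + -((x i : ℚ) - N)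
      simp
    rw [mul_laurentCochain, congrArg (monomial R) hxl, monomial_add, map_mul, mul_assoc,
      mul_negMonomialCochain, mul_one]
  · push Not at h
    obtain ⟨i, hi⟩ := h
    have hle : N • Pi.single i 1 ≤ x := by
      intro j
      by_cases hj : j = i
      · subst hj
        simpa using hi
      · rw [Pi.smul_apply, Pi.single_eq_of_ne hj, smul_zero]
        exact zero_le
    obtain ⟨y, rfl⟩ := exists_add_of_le hle
    set σ : Fin (k + 1) ↪o Fin (k + 2) :=
      (Fin.succAboveOrderEmb i).trans (RelEmbedding.refl _)
    have h1 : (N • 1 : Fin (k + 2) → ℚ≥0) = N • Pi.single i 1 + N • coverExp σ := by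
      rw [← smul_add, ← coverExp_eq_one (RelEmbedding.refl _), coverExp_eq_single_add _ i]
      rfl
    have hy : monomial R y ∈ grading R (k + 1) (m + totalDeg (k + 1) (N • coverExp σ)) := by
      refine mem_grading_of_monomial_mul (e := N • Pi.single i 1) ?_
      have h2 : m + totalDeg (k + 1) (N • coverExp σ) + totalDeg (k + 1) (N • Pi.single i 1) =
          m + totalDeg (k + 1) (N • 1) := by
        rw [h1, map_add]
        ring
      rw [← monomial_add, h2]
      exact hx
    have hU : ∀ p ∈ inter (grading R (k + 1)) (stdCover R (k + 1)) σ,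
        monomial R (N • coverExp σ) ∉ p.asIdeal := fun p hp h => by
      rw [monomial_nsmul] at h
      exact (mem_inter_iff σ p).1 hp (p.isPrime.mem_of_pow_mem _ h)
    rw [topClass_eq_zero_of_extends i _
      (fracSection _ m (monomial_mem_grading (N • coverExp σ)) hU ⟨_, hy⟩)]
    · exact zero_mem _
    · refine section_ext (fun p hp => monomial_notMem_of_mem_inter R _ ⟨p, hp⟩ (N • 1))
        fun q => ?_
      refine (mul_laurentCochain _ _ q).trans (Eq.trans ?_ (map_mul_eq_of_eq_mul _
        ((congrArg (monomial R) h1).trans (monomial_add R _ _))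
        (mul_fracSection (monomial_mem_grading (N • coverExp σ)) hU ⟨_, hy⟩
          ⟨q.1, inter_le _ _ _ i q.2⟩)).symm)
      exact congrArg _ (monomial_add R _ _)

theorem span_negMonomialClass {k : ℕ} (m : ℚ) :
    Submodule.span R (Set.range (negMonomialClass R (n := k + 1) (m := m))) = ⊤ := by
  refine Submodule.eq_top_iff'.2 fun z => ?_
  obtain ⟨c, rfl⟩ := topClass_surjective m z
  obtain ⟨N, b, rfl⟩ := exists_eq_laurentCochain c
  have hdeg : ∀ x ∈ b.1.coeff.support, totalDeg (k + 1) x = m + totalDeg (k + 1) (N • 1) :=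
    fun x hx => b.2 x hx
  have hmem : ∀ x ∈ b.1.coeff.support,
      monomial R x ∈ grading R (k + 1) (m + totalDeg (k + 1) (N • 1)) := fun x hx => by
    rw [← hdeg x hx]
    exact monomial_mem_grading x
  have hb : b = ∑ x : b.1.coeff.support, b.1.coeff x • (⟨_, hmem x x.2⟩ : grading R (k + 1) _) := by
    refine Subtype.ext ?_
    rw [AddSubmonoidClass.coe_finsetSum]
    conv_lhs => rw [← AddMonoidAlgebra.sum_coeff_single b.1, Finsupp.sum, ← Finset.sum_coe_sort]
    refine Finset.sum_congr rfl fun x _ => ?_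
    change _ = b.1.coeff x • monomial R x.1
    rw [monomial, AddMonoidAlgebra.smul_single, smul_eq_mul, mul_one]
  rw [hb, map_sum, map_sum]
  refine sum_mem fun x _ => ?_
  rw [map_smul, map_smul]
  exact Submodule.smul_mem _ _
    (topClass_laurentCochain_monomial_mem (hmem x x.2) (hdeg x x.2))

theorem negVec_injective {m : ℚ} : Function.Injective (negVec (n := n) (m := m)) := by
  intro l l' h
  refine Subtype.ext (funext fun i => ?_)
  have := congrArg (NNRat.cast (K := ℚ)) (congrFun h i)
  exact neg_injective this

/-- In a relation `∑ v_l X^l = ∑ ± s_i`, with `s_i` extending to the intersection of all `U_j`,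
`j ≠ i`, clear denominators by `(X_0 ⋯ X_n) ^ N`: all monomials on the right-hand side become
divisible by some `X_i ^ N`, and none on the left-hand side is. -/
theorem linearIndependent_negMonomialClass {k : ℕ} (m : ℚ) :
    LinearIndependent R (negMonomialClass R (n := k + 1) (m := m)) := by
  rw [linearIndependent_iff]
  intro v hv
  let τ : Fin (k + 2) ↪o Fin (k + 2) := RelEmbedding.refl _
  have hcls : Finsupp.linearCombination R (negMonomialClass R (n := k + 1) (m := m)) v =
      topClass m (∑ l ∈ v.support, v l • negMonomialCochain R l) := by
    rw [map_sum]
    refine Finset.sum_congr rfl fun l _ => ?_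
    rw [map_smul]
    rfl
  rw [hcls, topClass_eq_zero_iff] at hv
  obtain ⟨s, hs⟩ := hv
  have hs := congrArg (component R τ) hs
  rw [component_cechD] at hs
  have hloc := fun j : Fin (k + 2) =>
    exists_pow_mul_section_eq (totalDeg_coverExp_pos ((Fin.succAboveOrderEmb j).trans τ))
      (monomial_mem_grading _) (fun p => mem_inter_iff _ p)
      (component R ((Fin.succAboveOrderEmb j).trans τ) s)
  choose N₀ hN₀ using hloc
  obtain ⟨N, hN, hNv⟩ : ∃ N : ℕ, (∀ j, N₀ j ≤ N) ∧ ∀ l ∈ v.support, negVec l ≤ N • 1 := by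
    refine ⟨Finset.univ.sup N₀ + v.support.sup fun l => Finset.univ.sup fun i => ⌈negVec l i⌉₊,
      fun j => (Finset.le_sup (Finset.mem_univ j)).trans le_self_add, fun l hl i => ?_⟩
    have h1 : ⌈negVec l i⌉₊ ≤ v.support.sup fun l => Finset.univ.sup fun i => ⌈negVec l i⌉₊ :=
      (Finset.le_sup (f := fun i => ⌈negVec l i⌉₊) (Finset.mem_univ i)).trans
        (Finset.le_sup (f := fun l => Finset.univ.sup fun i => ⌈negVec l i⌉₊) hl)
    rw [Pi.smul_apply, Pi.one_apply, nsmul_one]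
    exact (Nat.le_ceil _).trans (Nat.cast_le.2 (h1.trans le_add_self))
  choose b hb hsb using fun j => hN₀ j N (hN j)
  choose! y hy using fun l hl => exists_add_of_le (hNv l hl)
  simp only [← monomial_nsmul, ← map_nsmul] at hb hsb
  have hsplit : ∀ j, (N • 1 : Fin (k + 2) → ℚ≥0) =
      N • Pi.single j 1 + N • coverExp ((Fin.succAboveOrderEmb j).trans τ) := by
    intro j
    rw [← smul_add, ← coverExp_eq_one τ, coverExp_eq_single_add _ j]
    rfl
  -- The relation with denominators cleared is an identity of polynomials.
  have hpoly : ∑ j : Fin (k + 2), (-1 : R) ^ (j : ℕ) • (monomial R (N • Pi.single j 1) * b j) =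
      ∑ l ∈ v.support, v l • monomial R (y l) := by
    refine eq_of_forall_localization (totalDeg_coverExp_pos τ)
      (d := m + totalDeg (k + 1) (N • 1))
      (sum_mem fun j _ => Submodule.smul_mem _ _ ?_) (sum_mem fun l hl => Submodule.smul_mem _ _ ?_)
      fun q hq => ?_
    · have := SetLike.GradedMul.mul_mem (monomial_mem_grading (R := R) (N • Pi.single j 1)) (hb j)
      rwa [add_left_comm, ← map_add, ← hsplit] at this
    · have := monomial_mem_grading (R := R) (y l)
      have h0 : m + totalDeg (k + 1) (negVec l) = 0 := by
        have h : totalDeg (k + 1) (negVec l) = ∑ i, -l.1 i := rfl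
        rw [h, Finset.sum_neg_distrib, l.2.2, add_neg_cancel]
      rwa [hy l hl, map_add, ← add_assoc, h0, zero_add]
    · have hq' : q ∈ inter (grading R (k + 1)) (stdCover R (k + 1)) τ := (mem_inter_iff τ q).2 hq
      let φ := IsScalarTower.toAlgHom R (Poly R (k + 1)) (Localization.AtPrime q.asIdeal)
      have hsq := congrArg (fun f => φ (monomial R (N • 1)) * sectionAt ⟨q, hq'⟩ f) hs
      simp only [map_sum, map_smul, Finset.mul_sum, mul_smul_comm] at hsq
      change φ _ = φ _
      rw [map_sum, map_sum]
      simp only [map_smul]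
      have hterm : ∀ j, φ (monomial R (N • 1)) * sectionAt ⟨q, hq'⟩
          (restrict (grading R (k + 1)) (inter_le (grading R (k + 1)) (stdCover R (k + 1)) τ j) m
            (component R ((Fin.succAboveOrderEmb j).trans τ) s)) =
          φ (monomial R (N • Pi.single j 1) * b j) := by
        intro j
        exact map_mul_eq_of_eq_mul φ.toRingHom
          ((congrArg (monomial R) (hsplit j)).trans (monomial_add R _ _))
          (hsb j ⟨q, inter_le (grading R (k + 1)) (stdCover R (k + 1)) τ j hq'⟩)
      have hterm' : ∀ l ∈ v.support, φ (monomial R (N • 1)) * sectionAt ⟨q, hq'⟩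
          (component R τ (negMonomialCochain R l)) = φ (monomial R (y l)) := by
        intro l hl
        exact (map_mul_eq_of_eq_mul φ.toRingHom
          ((congrArg (monomial R) ((hy l hl).trans (add_comm _ _))).trans (monomial_add R _ _))
          ((mul_negMonomialCochain l τ ⟨q, hq'⟩).trans (map_one _).symm)).trans
          (congrArg _ (mul_one _))
      refine Eq.trans (Finset.sum_congr rfl fun j _ => ?_) (hsq.trans
        (Finset.sum_congr rfl fun l hl => ?_))
      · rw [hterm]
      · rw [hterm' l hl]
  refine Finsupp.ext fun l => ?_
  by_contra hl
  have hl' : l ∈ v.support := Finsupp.mem_support_iff.2 hl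
  have hcoeff := congrArg (fun a => a.coeff (y l)) hpoly
  simp only [AddMonoidAlgebra.coeff_sum, Finsupp.finsetSum_apply,
    AddMonoidAlgebra.coeff_smul_apply] at hcoeff
  rw [Finset.sum_eq_zero, Finset.sum_eq_single l] at hcoeff
  · rw [monomial, AddMonoidAlgebra.coeff_single, Finsupp.single_eq_same, smul_eq_mul, mul_one]
      at hcoeff
    exact hl hcoeff.symm
  · intro l' hl' hne
    rw [monomial, AddMonoidAlgebra.coeff_single, Finsupp.single_eq_of_ne, smul_zero]
    intro h
    apply hne
    refine negVec_injective (add_right_cancel (b := y l) ?_)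
    rw [← hy l ‹_›, h, ← hy l' hl']
  · intro h
    exact absurd hl' h
  · intro j _
    rw [coeff_monomial_mul_of_not_le, smul_zero]
    intro hle
    have h1 := hle j
    have h2 := congrFun (hy l hl') j
    have h3 : 0 < negVec l j := by
      rw [← NNRat.coe_pos]
      exact neg_pos.2 (l.2.1 j)
    simp only [Pi.smul_apply, Pi.single_eq_same, Pi.one_apply, Pi.add_apply] at h1 h2
    rw [h2] at h1
    exact absurd h1 (not_le.2 (lt_add_of_pos_left _ h3))

theorem mk_negExp (hn : 1 ≤ n) {m : ℚ} (hm : m < 0) :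
    Cardinal.mk (NegExp n m) = Cardinal.aleph0 := by
  have : Countable (NegExp n m) := inferInstanceAs (Countable {_l : Fin (n + 1) → ℚ // _})
  have hn' : (0 : ℚ) < n := by exact_mod_cast hn
  have ht : ∀ k : ℕ, (0 : ℚ) < 1 / (k + 2) ∧ (1 : ℚ) / (k + 2) < 1 := fun k =>
    ⟨by positivity, by rw [div_lt_one (by positivity)]; linarith [k.cast_nonneg (α := ℚ)]⟩
  -- With `0 < t < 1`, the exponents `m * t, m * (1 - t) / n, …, m * (1 - t) / n` are negative.
  let f : ℕ → NegExp n m := fun k =>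
    ⟨Fin.cons (m * (1 / (k + 2))) fun _ => m * (1 - 1 / (k + 2)) / n, by
      refine Fin.cases ?_ fun i => ?_
      · rw [Fin.cons_zero]
        exact mul_neg_of_neg_of_pos hm (ht k).1
      · rw [Fin.cons_succ]
        exact div_neg_of_neg_of_pos (mul_neg_of_neg_of_pos hm (sub_pos.2 (ht k).2)) hn', by
      rw [Fin.sum_univ_succ]
      simp only [Fin.cons_zero, Fin.cons_succ, Finset.sum_const, Finset.card_univ,
        Fintype.card_fin, nsmul_eq_mul]
      field_simp
      ring⟩
  have hf : Function.Injective f := by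
    intro k k' h
    have h0 := congrFun (congrArg Subtype.val h) 0
    have h0 : m * (1 / (k + 2)) = m * (1 / (k' + 2)) := h0
    have h1 := mul_left_cancel₀ hm.ne h0
    rw [one_div, one_div, inv_inj] at h1
    exact_mod_cast add_right_cancel h1
  have : Infinite (NegExp n m) := Infinite.of_injective f hf
  exact Cardinal.mk_eq_aleph0 _

theorem exists_basis_negMonomialClass (hn : 1 ≤ n) (m : ℚ) :
    ∃ b : Module.Basis (NegExp n m) R (H R n n m), ∀ l, b l = negMonomialClass R l := by
  obtain ⟨k, rfl⟩ := Nat.exists_eq_add_of_le' hn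
  exact ⟨Module.Basis.mk (linearIndependent_negMonomialClass m) (span_negMonomialClass m).ge,
    fun l => Module.Basis.mk_apply _ _ l⟩

theorem rank_H (hn : 1 ≤ n) [Nontrivial R] {m : ℚ} (hm : m < 0) :
    Module.rank R (H R n n m) = Cardinal.aleph0 := by
  obtain ⟨b, -⟩ := exists_basis_negMonomialClass (R := R) hn m
  have h := b.mk_eq_rank
  rw [mk_negExp hn hm, Cardinal.lift_aleph0] at h
  exact (Cardinal.lift_eq_aleph0.1 h.symm)

end TopCohomology

end RatProj

end

theorem mainTheorem2 {R : Type*} [CommRing R] (n : ℕ) (hn : 1 ≤ n) :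
    (∃ φ : RatProj.Poly R n ≃ₐ[R] (⨁ m : ℚ, RatProj.H0 (RatProj.grading R n) m),
      ∀ (m : ℚ) (f : RatProj.grading R n m),
        φ (f : RatProj.Poly R n) =
          DirectSum.of (fun m : ℚ => RatProj.H0 (RatProj.grading R n) m) m
            (RatProj.toH0 (RatProj.grading R n) m f)) ∧
    (∀ m : ℚ, ∃ b : Module.Basis (RatProj.NegExp n m) R (RatProj.H R n n m),
      ∀ l, b l = RatProj.negMonomialClass R l) ∧
    (Nontrivial R → ∀ m : ℚ, m < 0 → Module.rank R (RatProj.H R n n m) = Cardinal.aleph0) ∧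
    (Nontrivial R →
      Module.rank R (RatProj.H R n n (-(n : ℚ) - 1)) = Cardinal.aleph0) := by
  refine ⟨RatProj.exists_algEquiv_of_bijective fun m =>
    ⟨RatProj.toH0_injective m, RatProj.toH0_surjective hn m⟩,
    RatProj.exists_basis_negMonomialClass hn, fun _ m hm => RatProj.rank_H hn hm,
    fun _ => RatProj.rank_H hn ?_⟩
  have : (0 : ℚ) ≤ n := n.cast_nonneg
  linarith
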